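/- **Steady state of the PASEP.** Let $n\ge 0$ and $q\ge 0$. Consider the partially asymmetric exclusion process (PASEP) on a one-dimensional lattice of $n$ sites, numbered from right to left by $1,\dots,n$. This is the continuous-time Markov chain on the $2^n$ configurations with at most one particle per site in which each particle hops to the site directly to its right, if that is empty, at rate $1$; hops to the site directly to its left, if that is empty, at rate $q$; a particle enters at the leftmost site, if that is empty, at rate $1$; and a particle at the rightmost site exits at rate $1$ (no particle exits on the left or enters on the right). For a composition $I=(i_1,\dots,i_r)$ of $n+1$ let $\ell(I)=r$ and $\operatorname{Des}(I)=\{i_1,\,i_1+i_2,\dots,i_1+\cdots+i_{r-1}\}\subseteq\{1,\dots,n\}$; write $J\succeq I$ ($J$ is coarser than $I$) if $\operatorname{Des}(J)\subseteq\operatorname{Des}(I)$. Put $\mathrm{st}'(I,J)=\#\{(i,j)\in\operatorname{Des}(I)\times\operatorname{Des}(J): i\le j\}$, $[k]_q=1+q+\cdots+q^{k-1}$, and $\mathrm{QFact}_A(j_1,\dots,j_p)=[p]_q^{j_1}[p-1]_q^{j_2}\cdots[2]_q^{j_{p-1}}[1]_q^{j_p}$. Let $Z_n$ be the partition function of this PASEP,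 $Z_n=\langle W|(D+E)^n|V\rangle$, where $D,E$ are linear operators, $|V\rangle$ a vector and $\langle W|$ a linear form with $DE-qED=D+E$, $D|V\rangle=|V\rangle$, $\langle W|E=\langle W|$ and $\langle W|V\rangle=1$ (such data exist, and $Z_n$ does not depend on their choice). Then the PASEP has a unique stationary distribution, and for every composition $I$ of $n+1$ its probability of the state $\tau$ in which the sites of $\operatorname{Des}(I)$ are occupied and the sites of $\{1,\dots,n\}\setminus\operatorname{Des}(I)$ are empty is $$\frac{1}{Z_n}\sum_{J\succeq I}\left(-\frac1q\right)^{\ell(I)-\ell(J)}q^{-\mathrm{st}'(I,J)}\,\mathrm{QFact}_A(J).$$ The numerator is a polynomial in $q$; for $q=0$ it is understood as the value of this polynomial at $0$. -/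

import Mathlib

open Polynomial

namespace PASEP

/-! ## Compositions and the closed formula -/

/-- The descent set `{i₁, i₁ + i₂, …, i₁ + ⋯ + i_{r-1}}` of a composition `(i₁, …, i_r)`. -/
def des {m : ℕ} (I : Composition m) : Finset ℕ :=
  (Finset.Ico 1 I.length).image I.sizeUpTo

/-- The compositions `J` that are coarser than `I` (`I` itself included). -/
def coarser {m : ℕ} (I : Composition m) : Finset (Composition m) :=
  Finset.univ.filter fun J => des J ⊆ des I

/-- The statistic `st'(I, J) = #{(i, j) ∈ Des(I) × Des(J) | i ≤ j}`
(used only for `J` coarser than `I`). -/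
def st' {m : ℕ} (I J : Composition m) : ℕ :=
  ((des I ×ˢ des J).filter fun x => x.1 ≤ x.2).card

/-- The `q`-integer `[k]_q = 1 + q + ⋯ + q ^ (k - 1)`. -/
noncomputable def qInt (q : ℝ) (k : ℕ) : ℝ :=
  ∑ i ∈ Finset.range k, q ^ i

/-- The generalized `q`-factorial
`QFact_A(j₁, …, j_p) = [p]^{j₁} [p-1]^{j₂} ⋯ [2]^{j_{p-1}} [1]^{j_p}`. -/
noncomputable def qFact {m : ℕ} (q : ℝ) (J : Composition m) : ℝ :=
  ∏ i : Fin J.length, qInt q (J.length - i) ^ J.blocksFun i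

/-- The alternating sum
`∑_{J coarser than I} (-1/q)^{ℓ(I) - ℓ(J)} q^{-st'(I, J)} QFact_A(J)`, for `q ≠ 0`. -/
noncomputable def formula {m : ℕ} (I : Composition m) (q : ℝ) : ℝ :=
  ∑ J ∈ coarser I,
    (-1 / q) ^ ((I.length : ℤ) - (J.length : ℤ)) * q ^ (-(st' I J : ℤ)) * qFact q J

/-! ## The exclusion process -/

/-- A state of the process on `n` sites.  The index `i : Fin n` is the site number `i + 1`, where
the sites are numbered from right to left by `1, …, n`; so index `n - 1` is the leftmost site and
index `0` the rightmost one.  The value `true` means that the site is occupied. -/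
abbrev State (n : ℕ) : Type := Fin n → Bool

/-- A particle hops from a site to the empty site directly to its right. -/
def HopRight {n : ℕ} (σ τ : State n) : Prop :=
  ∃ i j : Fin n, (j : ℕ) = i + 1 ∧ σ j = true ∧ σ i = false ∧
    τ = Function.update (Function.update σ j false) i true

/-- A particle hops from a site to the empty site directly to its left. -/
def HopLeft {n : ℕ} (σ τ : State n) : Prop :=
  ∃ i j : Fin n, (j : ℕ) = i + 1 ∧ σ i = true ∧ σ j = false ∧
    τ = Function.update (Function.update σ i false) j true

/-- A particle enters at the (empty) leftmost site. -/
def EnterLeft {n : ℕ} (σ τ : State n) : Prop :=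
  ∃ i : Fin n, (i : ℕ) + 1 = n ∧ σ i = false ∧ τ = Function.update σ i true

/-- A particle leaves from the (occupied) rightmost site. -/
def ExitRight {n : ℕ} (σ τ : State n) : Prop :=
  ∃ i : Fin n, (i : ℕ) = 0 ∧ σ i = true ∧ τ = Function.update σ i false

open Classical in
/-- The rate of the transition from `σ` to `τ` in the continuous-time Markov chain. -/
noncomputable def rate {n : ℕ} (q : ℝ) (σ τ : State n) : ℝ :=
  (if HopRight σ τ then 1 else 0) + (if HopLeft σ τ then q else 0) +
    (if EnterLeft σ τ then 1 else 0) + (if ExitRight σ τ then 1 else 0)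

/-- `p` is a stationary probability distribution of the process: for every state the total
probability flow into it equals the total flow out of it. -/
structure IsSteadyState (n : ℕ) (q : ℝ) (p : State n → ℝ) : Prop where
  nonneg : ∀ τ, 0 ≤ p τ
  sum_eq_one : ∑ τ, p τ = 1
  balance : ∀ τ, ∑ σ, p σ * rate q σ τ = p τ * ∑ σ, rate q τ σ

/-- The state whose set of occupied sites is `Des(I)`. -/
def stateOf {n : ℕ} (I : Composition (n + 1)) : State n :=
  fun i => decide ((i : ℕ) + 1 ∈ des I)

/-! ## The partition function

The partition function is `Z_n = ⟨W| (D + E)^n |V⟩`, where the operators `D`, `E`, the vector `V`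
and the linear form `W` satisfy the relations of the matrix product ansatz
`D E - q E D = D + E`, `D V = V`, `W E = W`, `W V = 1`.
They are realised on `ℝ[X]`: `V = 1`, `E` is multiplication by `X`, `W` is evaluation at `1`. -/

/-- The image of `X ^ k` under the operator `D`. -/
noncomputable def opDAux (q : ℝ) : ℕ → ℝ[X]
  | 0 => 1
  | k + 1 => (1 + C q * X) * opDAux q k + X ^ (k + 1)

/-- The operator `D` of the matrix product ansatz. -/
noncomputable def opD (q : ℝ) : ℝ[X] →ₗ[ℝ] ℝ[X] :=
  (Polynomial.basisMonomials ℝ).constr ℝ (opDAux q)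

/-- The operator `E` of the matrix product ansatz. -/
noncomputable def opE : ℝ[X] →ₗ[ℝ] ℝ[X] := LinearMap.mulLeft ℝ X

/-- The partition function `Z_n = ⟨W| (D + E)^n |V⟩` of the process on `n` sites. -/
noncomputable def partitionFunction (n : ℕ) (q : ℝ) : ℝ :=
  (((opD q + opE) ^ n) 1).eval 1

theorem basis_apply (k : ℕ) : Polynomial.basisMonomials ℝ k = X ^ k := by
  simp [Polynomial.coe_basisMonomials, Polynomial.monomial_one_right_eq_X_pow]

theorem opD_X_pow (q : ℝ) (k : ℕ) : opD q (X ^ k) = opDAux q k := by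
  have h := (Polynomial.basisMonomials ℝ).constr_basis ℝ (opDAux q) k
  rw [basis_apply] at h
  exact h

theorem opD_one (q : ℝ) : opD q 1 = 1 := by
  simpa [opDAux] using opD_X_pow q 0

theorem opD_mul_opE (q : ℝ) : opD q * opE - q • (opE * opD q) = opD q + opE := by
  refine (Polynomial.basisMonomials ℝ).ext fun k => ?_
  rw [basis_apply]
  simp only [LinearMap.sub_apply, LinearMap.smul_apply, LinearMap.add_apply, Module.End.mul_apply,
    opE, LinearMap.mulLeft_apply, ← pow_succ', opD_X_pow, opDAux, Polynomial.smul_eq_C_mul]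
  ring

theorem eval_opE (p : ℝ[X]) : (opE p).eval 1 = p.eval 1 := by
  simp [opE]

/-- The value `⟨W| (D + E)^n |V⟩` is the same for every solution of the matrix product ansatz. -/
theorem partitionFunction_eq {M : Type*} [AddCommGroup M] [Module ℝ M] (q : ℝ)
    (D E : Module.End ℝ M) (V : M) (W : M →ₗ[ℝ] ℝ) (hDE : D * E - q • (E * D) = D + E)
    (hD : D V = V) (hE : ∀ x, W (E x) = W x) (hWV : W V = 1) (n : ℕ) :
    W (((D + E) ^ n) V) = partitionFunction n q := by
  let φ : ℝ[X] →ₗ[ℝ] M := (LinearMap.applyₗ V).comp (Polynomial.aeval E).toLinearMap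
  have hφ : ∀ p, φ p = Polynomial.aeval E p V := fun p => rfl
  have hφE : ∀ p, φ (opE p) = E (φ p) := fun p => by simp [hφ, opE]
  have hrel : ∀ x, D (E x) = q • E (D x) + D x + E x := fun x => by
    have := LinearMap.congr_fun hDE x
    simp only [LinearMap.sub_apply, LinearMap.smul_apply, LinearMap.add_apply,
      Module.End.mul_apply] at this
    rw [sub_eq_iff_eq_add] at this
    rw [this]; abel
  have hφD : φ ∘ₗ opD q = D ∘ₗ φ := by
    refine (Polynomial.basisMonomials ℝ).ext fun k => ?_
    rw [basis_apply]
    simp only [LinearMap.comp_apply, opD_X_pow]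
    induction k with
    | zero => simp [hφ, opDAux, hD]
    | succ k ih =>
      have h1 : φ (X ^ (k + 1)) = E (φ (X ^ k)) := by
        rw [← hφE]; simp [opE, pow_succ']
      have h2 : opDAux q (k + 1) = opDAux q k + q • opE (opDAux q k) + X ^ (k + 1) := by
        simp only [opDAux, opE, LinearMap.mulLeft_apply, Polynomial.smul_eq_C_mul]; ring
      rw [h2, map_add, map_add, map_smul, hφE, ih, h1, hrel]
      abel
  have hpow : ∀ m : ℕ, φ (((opD q + opE) ^ m) 1) = ((D + E) ^ m) V := by
    intro m
    induction m with
    | zero => simp [hφ]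
    | succ m ih =>
      rw [pow_succ', pow_succ', Module.End.mul_apply, Module.End.mul_apply, ← ih,
        LinearMap.add_apply, LinearMap.add_apply, map_add, hφE]
      exact congrArg (· + _) (LinearMap.congr_fun hφD _)
  have hW : W ∘ₗ φ = (Polynomial.leval (1 : ℝ)) := by
    refine (Polynomial.basisMonomials ℝ).ext fun k => ?_
    rw [basis_apply]
    simp only [LinearMap.comp_apply]
    induction k with
    | zero => simp [hφ, hWV]
    | succ k ih =>
      have h1 : φ (X ^ (k + 1)) = E (φ (X ^ k)) := by
        rw [← hφE]; simp [opE, pow_succ']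
      rw [h1, hE, ih]; simp
  rw [← hpow]
  exact LinearMap.congr_fun hW _

end PASEP

/-!
The stationary distribution is the normalised matrix product `τ ↦ ⟨W| X_n ⋯ X_1 |V⟩`, with `X_i = D`
at the occupied sites and `X_i = E` at the empty ones, realised on `ℝ[X]` (`weight`).

*Stationarity* (`weight_balance`). By `D E - q E D = D + E` the net flow into a state across the bond
between two adjacent sites is a difference of two signed weights, each of the state with one of these
sites removed (`bond_flow`). These telescope along the lattice, and `⟨W|E = ⟨W|`, `D|V⟩ = |V⟩` make
the two boundary flows cancel what is left. All weights are positive, since `D` and `E` preserve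
polynomials with nonnegative coefficients (`stateVec_pos`), and they add up to `⟨W|(D+E)^n|V⟩`.

*Uniqueness* (`IsSteadyState.eq_of_pos`). The process is irreducible even for `q = 0`: every state can
be emptied by moving its rightmost particle to the right and out, and can be built from the empty
state by bringing in particles from the left (`mem_of_predecessor_closed`). Subtracting from a second
stationary distribution the largest possible multiple of the first leaves a nonnegative solution of
the balance equations with a zero, which must vanish identically.

*The formula* (`weight_stateOf`). For `q ≠ 0`, on the values of polynomials at the points `[c]_q` the
operator `E` is multiplication by `[c]_q`, and `D` is the `q`-difference operator
`f ↦ q^{-c} ([c+1]_q f([c+1]_q) - [c]_q f([c]_q))` (`eval_opD`). So a product of operators expands into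
a sum over the subsets `T` of the set of occupied sites, one for each choice of one of the two terms
of every `D` (`weight_eq_sum`). Subsets correspond to coarser compositions through descent sets, and
the terms to those of the formula. Finally `D` and `E` have coefficients in `ℤ[q]`, so that each
weight is a polynomial in `q` (`exists_eval_eq_weight`), which also covers `q = 0`.
-/

namespace PASEP

/-! ### Matrix products -/

/-- The product `A_{n-1} ⋯ A_1 A_0`: the factors are written in the order of the sites, which are
numbered from right to left. -/
def opWord {R : Type*} [Monoid R] : {n : ℕ} → (Fin n → R) → R
  | 0, _ => 1
  | n + 1, A => A (Fin.last n) * opWord fun i : Fin n => A i.castSucc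

theorem opWord_succ_right {R : Type*} [Monoid R] {n : ℕ} (A : Fin (n + 1) → R) :
    opWord A = (opWord fun i : Fin n => A i.succ) * A 0 := by
  induction n with
  | zero => simp [opWord]
  | succ n ih =>
    rw [opWord, ih, ← mul_assoc]
    rfl

/-- A product of operators, as a function of the two adjacent factors at `k` and `k + 1`. -/
theorem exists_opWord_eq_mul_mul {R : Type*} [Monoid R] {m : ℕ} (A : Fin (m + 1) → R)
    (k : Fin m) : ∃ L N : R, ∀ B : Fin (m + 1) → R,
      (∀ i, i ≠ k.castSucc → i ≠ k.succ → B i = A i) →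
        opWord B = L * ((B k.succ * B k.castSucc) * N) := by
  induction m with
  | zero => exact k.elim0
  | succ m ih =>
    induction k using Fin.lastCases with
    | last =>
      refine ⟨1, opWord fun i : Fin m => A i.castSucc.castSucc, fun B hB => ?_⟩
      have : (fun i : Fin m => B i.castSucc.castSucc) = fun i => A i.castSucc.castSucc := by
        funext i
        apply hB
        · simpa [Fin.ext_iff] using i.2.ne
        · simp only [ne_eq, Fin.ext_iff, Fin.val_castSucc, Fin.val_succ, Fin.val_last]
          have := i.2
          omega
      rw [opWord, opWord, this, one_mul, mul_assoc]
      rfl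
    | cast k =>
      obtain ⟨L, N, h⟩ := ih (fun i => A i.castSucc) k
      refine ⟨A (Fin.last _) * L, N, fun B hB => ?_⟩
      rw [opWord, h, hB (Fin.last _), ← mul_assoc]
      · rfl
      · exact (Fin.castSucc_lt_last _).ne'
      · rw [Fin.succ_castSucc]
        exact (Fin.castSucc_lt_last _).ne'
      · intro i h1 h2
        apply hB
        · simpa using h1
        · rw [Fin.succ_castSucc]
          exact fun h => h2 (Fin.castSucc_injective _ h)

/-- The operator of a single site: `D` for a particle, `E` for a hole. -/
noncomputable def siteOp (q : ℝ) (b : Bool) : Module.End ℝ ℝ[X] :=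
  if b then opD q else opE

/-- The vector obtained by applying the operators of all sites of `τ` to `V = 1`. -/
noncomputable def stateVec {n : ℕ} (q : ℝ) (τ : State n) : ℝ[X] :=
  opWord (fun i => siteOp q (τ i)) 1

/-- The unnormalised stationary weight `⟨W| X_n ⋯ X_1 |V⟩` of a state, where `X_i` is `D` or `E`
according to whether site `i` is occupied. -/
noncomputable def weight {n : ℕ} (q : ℝ) (τ : State n) : ℝ :=
  (stateVec q τ).eval 1

theorem stateVec_succ {n : ℕ} (q : ℝ) (τ : State (n + 1)) :
    stateVec q τ = siteOp q (τ (Fin.last n)) (stateVec q fun i : Fin n => τ i.castSucc) := by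
  simp [stateVec, opWord]

theorem sum_stateVec (n : ℕ) (q : ℝ) :
    ∑ τ : State n, stateVec q τ = ((opD q + opE) ^ n) 1 := by
  induction n with
  | zero => simp [stateVec, opWord]
  | succ n ih =>
    rw [pow_succ', Module.End.mul_apply, ← ih, ← (Fin.snocEquiv fun _ => Bool).sum_comp,
      Fintype.sum_prod_type]
    simp [stateVec_succ, Fin.snocEquiv, siteOp, map_sum,
      Finset.sum_add_distrib]

theorem sum_weight (n : ℕ) (q : ℝ) : ∑ τ : State n, weight q τ = partitionFunction n q := by
  simp only [weight, partitionFunction, ← sum_stateVec, eval_finsetSum]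

/-! ### Positivity -/

theorem coeff_opDAux_nonneg {q : ℝ} (hq : 0 ≤ q) (k i : ℕ) : 0 ≤ (opDAux q k).coeff i := by
  induction k generalizing i with
  | zero =>
    rw [opDAux, coeff_one]
    split_ifs <;> norm_num
  | succ k ih =>
    rw [opDAux, add_mul, one_mul, mul_assoc, coeff_add, coeff_add, coeff_C_mul, coeff_X_pow]
    have h : 0 ≤ (X * opDAux q k).coeff i := by
      cases i with
      | zero => simp
      | succ i => simpa using ih i
    have h2 : (0 : ℝ) ≤ if i = k + 1 then 1 else 0 := by split_ifs <;> norm_num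
    have := ih i
    positivity

theorem one_le_eval_opDAux {q : ℝ} (hq : 0 ≤ q) (k : ℕ) : 1 ≤ (opDAux q k).eval 1 := by
  induction k with
  | zero => simp [opDAux]
  | succ k ih =>
    simp only [opDAux, eval_add, eval_mul, eval_one, eval_C, eval_X, eval_pow, one_pow, mul_one]
    nlinarith

theorem opD_eq_sum (q : ℝ) (p : ℝ[X]) :
    opD q p = ∑ i ∈ Finset.range (p.natDegree + 1), C (p.coeff i) * opDAux q i := by
  conv_lhs => rw [p.as_sum_range_C_mul_X_pow]
  simp only [map_sum, ← smul_eq_C_mul, map_smul, opD_X_pow]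

/-- The matrix product vectors have nonnegative coefficients and are nonzero. -/
theorem stateVec_pos {n : ℕ} {q : ℝ} (hq : 0 ≤ q) (τ : State n) :
    (∀ i, 0 ≤ (stateVec q τ).coeff i) ∧ 0 < (stateVec q τ).eval 1 := by
  induction n with
  | zero =>
    simp only [stateVec, opWord, Module.End.one_apply, coeff_one, eval_one]
    refine ⟨fun i => ?_, one_pos⟩
    split_ifs <;> norm_num
  | succ n ih =>
    obtain ⟨h1, h2⟩ := ih fun i => τ i.castSucc
    rw [stateVec_succ]
    generalize stateVec q (fun i : Fin n => τ i.castSucc) = p at h1 h2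
    cases τ (Fin.last n) with
    | false =>
      simp only [siteOp, Bool.false_eq_true, if_false]
      refine ⟨fun i => ?_, by rwa [eval_opE]⟩
      cases i with
      | zero => simp [opE]
      | succ i => simpa [opE] using h1 i
    | true =>
      simp only [siteOp, if_true, opD_eq_sum]
      constructor
      · intro i
        rw [finsetSum_coeff]
        refine Finset.sum_nonneg fun j _ => ?_
        rw [coeff_C_mul]
        exact mul_nonneg (h1 j) (coeff_opDAux_nonneg hq j i)
      · refine h2.trans_le ?_
        rw [eval_eq_sum_range, eval_finsetSum]
        refine Finset.sum_le_sum fun j _ => ?_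
        rw [one_pow, eval_mul, eval_C]
        exact mul_le_mul_of_nonneg_left (one_le_eval_opDAux hq j) (h1 j)

theorem weight_pos {n : ℕ} {q : ℝ} (hq : 0 ≤ q) (τ : State n) : 0 < weight q τ :=
  (stateVec_pos hq τ).2

theorem partitionFunction_pos (n : ℕ) {q : ℝ} (hq : 0 ≤ q) : 0 < partitionFunction n q := by
  rw [← sum_weight]
  exact Finset.sum_pos (fun τ _ => weight_pos hq τ) Finset.univ_nonempty

/-! ### Polynomial dependence on `q` -/

/-- Each `opDAux q k` is the specialisation at `q` of a fixed polynomial with coefficients in `ℝ[q]`. -/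
theorem exists_map_eq_opDAux (k : ℕ) :
    ∃ G : ℝ[X][X], ∀ q : ℝ, G.map (evalRingHom q) = opDAux q k := by
  induction k with
  | zero => exact ⟨1, fun q => by simp [opDAux]⟩
  | succ k ih =>
    obtain ⟨G, hG⟩ := ih
    exact ⟨(1 + C X * X) * G + X ^ (k + 1), fun q => by simp [opDAux, hG]⟩

theorem exists_map_eq_opD (F : ℝ[X][X]) :
    ∃ G : ℝ[X][X], ∀ q : ℝ, G.map (evalRingHom q) = opD q (F.map (evalRingHom q)) := by
  choose A hA using exists_map_eq_opDAux
  refine ⟨∑ i ∈ Finset.range (F.natDegree + 1), C (F.coeff i) * A i, fun q => ?_⟩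
  conv_rhs => rw [F.as_sum_range_C_mul_X_pow]
  simp [Polynomial.map_sum, hA, ← smul_eq_C_mul, map_sum, opD_X_pow]

theorem exists_map_eq_stateVec {n : ℕ} (τ : State n) :
    ∃ G : ℝ[X][X], ∀ q : ℝ, G.map (evalRingHom q) = stateVec q τ := by
  induction n with
  | zero => exact ⟨1, fun q => by simp [stateVec, opWord]⟩
  | succ n ih =>
    obtain ⟨F, hF⟩ := ih fun i => τ i.castSucc
    simp only [stateVec_succ, ← hF]
    cases τ (Fin.last n) with
    | false => exact ⟨X * F, fun q => by simp [siteOp, opE]⟩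
    | true => simpa [siteOp] using exists_map_eq_opD F

/-- The weight of a state is a polynomial in `q`. -/
theorem exists_eval_eq_weight {n : ℕ} (τ : State n) :
    ∃ P : ℝ[X], ∀ q : ℝ, P.eval q = weight q τ := by
  obtain ⟨G, hG⟩ := exists_map_eq_stateVec τ
  refine ⟨G.eval 1, fun q => ?_⟩
  rw [weight, ← hG, eval_map, eval₂_at_one, coe_evalRingHom]

/-! ### Transitions as sums over bonds -/

/-- The state with the contents of the sites `k` and `k + 1` exchanged. -/
def swapAt {m : ℕ} (k : Fin m) (τ : State (m + 1)) : State (m + 1) :=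
  τ ∘ Equiv.swap k.castSucc k.succ

@[simp]
theorem swapAt_swapAt {m : ℕ} (k : Fin m) (τ : State (m + 1)) : swapAt k (swapAt k τ) = τ := by
  funext i
  simp [swapAt]

theorem swapAt_eq_update {m : ℕ} (k : Fin m) (τ : State (m + 1)) :
    swapAt k τ =
      Function.update (Function.update τ k.succ (τ k.castSucc)) k.castSucc (τ k.succ) := by
  funext i
  simp only [swapAt, Function.comp_apply, Function.update_apply, Equiv.swap_apply_def]
  split_ifs <;> rfl

theorem hopRight_iff {m : ℕ} (σ τ : State (m + 1)) :
    HopRight σ τ ↔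
      ∃ k : Fin m, (σ k.succ = true ∧ σ k.castSucc = false) ∧ τ = swapAt k σ := by
  constructor
  · rintro ⟨i, j, hij, hj, hi, h⟩
    have hi' : (i : ℕ) < m := by have := j.2; omega
    obtain ⟨k, rfl⟩ : ∃ k : Fin m, i = k.castSucc := ⟨⟨i, hi'⟩, rfl⟩
    obtain rfl : j = k.succ := Fin.ext hij
    exact ⟨_, ⟨hj, hi⟩, by rw [h, swapAt_eq_update, hj, hi]⟩
  · rintro ⟨k, ⟨hj, hi⟩, h⟩
    exact ⟨k.castSucc, k.succ, by simp, hj, hi, by rw [h, swapAt_eq_update, hj, hi]⟩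

theorem hopLeft_iff {m : ℕ} (σ τ : State (m + 1)) :
    HopLeft σ τ ↔
      ∃ k : Fin m, (σ k.succ = false ∧ σ k.castSucc = true) ∧ τ = swapAt k σ := by
  constructor
  · rintro ⟨i, j, hij, hi, hj, h⟩
    have hi' : (i : ℕ) < m := by have := j.2; omega
    obtain ⟨k, rfl⟩ : ∃ k : Fin m, i = k.castSucc := ⟨⟨i, hi'⟩, rfl⟩
    obtain rfl : j = k.succ := Fin.ext hij
    refine ⟨_, ⟨hj, hi⟩, ?_⟩
    rw [h, swapAt_eq_update, hj, hi, Function.update_comm]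
    simp [Fin.ext_iff]
  · rintro ⟨k, ⟨hj, hi⟩, h⟩
    refine ⟨k.castSucc, k.succ, by simp, hi, hj, ?_⟩
    rw [h, swapAt_eq_update, hj, hi, Function.update_comm]
    simp [Fin.ext_iff]

theorem hopLeft_iff_hopRight {m : ℕ} (σ τ : State (m + 1)) : HopLeft σ τ ↔ HopRight τ σ := by
  rw [hopLeft_iff, hopRight_iff]
  refine exists_congr fun k => ?_
  constructor
  · rintro ⟨h, rfl⟩
    exact ⟨by simpa [swapAt] using h.symm, by simp⟩
  · rintro ⟨h, rfl⟩
    exact ⟨by simpa [swapAt] using h.symm, by simp⟩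

/-- A transition determines the bond across which the particle hops. -/
theorem bond_unique {m : ℕ} {σ : State (m + 1)} {k l : Fin m}
    (hk : σ k.succ = true ∧ σ k.castSucc = false) (hl : σ l.succ = true ∧ σ l.castSucc = false)
    (h : swapAt k σ = swapAt l σ) : k = l := by
  have h1 := congrFun h k.succ
  have h2 : swapAt k σ k.succ = false := by simpa [swapAt] using hk.2
  rw [h2, swapAt, Function.comp_apply, Equiv.swap_apply_def] at h1
  split_ifs at h1 with h3 h4
  · rw [h3, hl.2] at hk
    simp at hk
  · exact Fin.succ_injective _ h4
  · rw [hk.1] at h1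
    simp at h1

theorem sum_mul_ite_eq {n : ℕ} (g : State n → ℝ) {Q : State n → Prop} [DecidablePred Q]
    {c : Prop} [Decidable c] {σ₀ : State n}
    (h : ∀ σ, Q σ ↔ c ∧ σ = σ₀) :
    ∑ σ, g σ * (if Q σ then 1 else 0) = if c then g σ₀ else 0 := by
  by_cases hc : c <;> simp [h, hc]

open Classical in
theorem ite_hopRight {m : ℕ} (σ τ : State (m + 1)) :
    (if HopRight σ τ then (1 : ℝ) else 0) = ∑ k : Fin m,
      if (σ k.succ = true ∧ σ k.castSucc = false) ∧ τ = swapAt k σ then 1 else 0 := by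
  split_ifs with h
  · obtain ⟨k, hk, rfl⟩ := (hopRight_iff σ _).1 h
    rw [Finset.sum_eq_single k]
    · simp [hk]
    · intro l _ hl
      rw [if_neg]
      rintro ⟨hl', h'⟩
      exact hl (bond_unique hl' hk h'.symm)
    · simp
  · rw [hopRight_iff] at h
    push Not at h
    exact (Finset.sum_eq_zero fun k _ => if_neg fun hk => h k hk.1 hk.2).symm

open Classical in
theorem sum_hopRight_from {m : ℕ} (g : State (m + 1) → ℝ) (τ : State (m + 1)) :
    ∑ σ, g σ * (if HopRight τ σ then 1 else 0) = ∑ k : Fin m,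
      if τ k.succ = true ∧ τ k.castSucc = false then g (swapAt k τ) else 0 := by
  simp only [ite_hopRight, Finset.mul_sum]
  rw [Finset.sum_comm]
  exact Finset.sum_congr rfl fun k _ => sum_mul_ite_eq g fun σ => Iff.rfl

open Classical in
theorem sum_hopRight_to {m : ℕ} (g : State (m + 1) → ℝ) (τ : State (m + 1)) :
    ∑ σ, g σ * (if HopRight σ τ then 1 else 0) = ∑ k : Fin m,
      if τ k.succ = false ∧ τ k.castSucc = true then g (swapAt k τ) else 0 := by
  simp only [ite_hopRight, Finset.mul_sum]
  rw [Finset.sum_comm]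
  refine Finset.sum_congr rfl fun k _ => sum_mul_ite_eq g fun σ => ?_
  constructor
  · rintro ⟨h, rfl⟩
    exact ⟨by simpa [swapAt] using h.symm, by simp⟩
  · rintro ⟨h, rfl⟩
    exact ⟨by simpa [swapAt] using h.symm, by simp⟩

theorem update_eq_update_iff {m : ℕ} {σ τ : State m} {i : Fin m} {a b : Bool} :
    (σ i = a ∧ τ = Function.update σ i b) ↔ (τ i = b ∧ σ = Function.update τ i a) := by
  constructor
  · rintro ⟨h, rfl⟩
    simp [← h]
  · rintro ⟨h, rfl⟩
    simp [← h]

theorem enterLeft_iff {m : ℕ} (σ τ : State (m + 1)) :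
    EnterLeft σ τ ↔ σ (Fin.last m) = false ∧ τ = Function.update σ (Fin.last m) true := by
  constructor
  · rintro ⟨i, hi, h⟩
    obtain rfl : i = Fin.last m := Fin.ext (by simpa using hi)
    exact h
  · exact fun h => ⟨Fin.last m, rfl, h⟩

theorem exitRight_iff {m : ℕ} (σ τ : State (m + 1)) :
    ExitRight σ τ ↔ σ 0 = true ∧ τ = Function.update σ 0 false := by
  constructor
  · rintro ⟨i, hi, h⟩
    obtain rfl : i = 0 := Fin.ext hi
    exact h
  · exact fun h => ⟨0, rfl, h⟩

/-- The total flow into `τ`, where the state `σ` carries the mass `p σ`. -/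
theorem sum_mul_rate_to {m : ℕ} (q : ℝ) (p : State (m + 1) → ℝ) (τ : State (m + 1)) :
    ∑ σ, p σ * rate q σ τ =
      ∑ k : Fin m, ((if τ k.succ = false ∧ τ k.castSucc = true then p (swapAt k τ) else 0) +
        q * if τ k.succ = true ∧ τ k.castSucc = false then p (swapAt k τ) else 0) +
      (if τ (Fin.last m) = true then p (Function.update τ (Fin.last m) false) else 0) +
      if τ 0 = false then p (Function.update τ 0 true) else 0 := by
  classical
  rw [Finset.sum_add_distrib, ← Finset.mul_sum, ← sum_hopRight_from, ← sum_hopRight_to,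
    ← sum_mul_ite_eq p fun σ => (enterLeft_iff σ τ).trans update_eq_update_iff,
    ← sum_mul_ite_eq p fun σ => (exitRight_iff σ τ).trans update_eq_update_iff,
    Finset.mul_sum, ← Finset.sum_add_distrib, ← Finset.sum_add_distrib, ← Finset.sum_add_distrib]
  refine Finset.sum_congr rfl fun σ _ => ?_
  simp only [rate, hopLeft_iff_hopRight]
  split_ifs <;> ring

/-- The total rate at which the process leaves `τ`. -/
theorem sum_rate_from {m : ℕ} (q : ℝ) (τ : State (m + 1)) :
    ∑ σ, rate q τ σ =
      ∑ k : Fin m, ((if τ k.succ = true ∧ τ k.castSucc = false then 1 else 0) +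
        q * if τ k.succ = false ∧ τ k.castSucc = true then 1 else 0) +
      (if τ (Fin.last m) = false then 1 else 0) + if τ 0 = true then 1 else 0 := by
  classical
  rw [Finset.sum_add_distrib, ← Finset.mul_sum, ← sum_hopRight_from (fun _ => (1 : ℝ)),
    ← sum_hopRight_to (fun _ => (1 : ℝ)),
    ← sum_mul_ite_eq (fun _ => (1 : ℝ)) fun σ => enterLeft_iff τ σ,
    ← sum_mul_ite_eq (fun _ => (1 : ℝ)) fun σ => exitRight_iff τ σ,
    Finset.mul_sum, ← Finset.sum_add_distrib, ← Finset.sum_add_distrib, ← Finset.sum_add_distrib]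
  refine Finset.sum_congr rfl fun σ _ => ?_
  simp only [rate, hopLeft_iff_hopRight]
  split_ifs <;> ring

/-! ### Stationarity of the matrix product weights -/

/-- The weight of `τ` with the site `i` removed from the lattice: its operator
is replaced by the identity. -/
noncomputable def weightRemove {n : ℕ} (q : ℝ) (τ : State n) (i : Fin n) : ℝ :=
  (opWord (Function.update (fun i => siteOp q (τ i)) i 1) 1).eval 1

/-- The sign `+1` of a particle and `-1` of a hole. -/
def siteSign (b : Bool) : ℝ := if b then 1 else -1

/-- The net flow into `τ` across one bond. The relation `D E - q E D = D + E` makes the sum of these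
flows over all bonds telescope. -/
theorem bond_flow {m : ℕ} (q : ℝ) (τ : State (m + 1)) (k : Fin m) :
    ((if τ k.succ = false ∧ τ k.castSucc = true then weight q (swapAt k τ) else 0) +
      q * if τ k.succ = true ∧ τ k.castSucc = false then weight q (swapAt k τ) else 0) -
    weight q τ * ((if τ k.succ = true ∧ τ k.castSucc = false then 1 else 0) +
      q * if τ k.succ = false ∧ τ k.castSucc = true then 1 else 0) =
    siteSign (τ k.castSucc) * weightRemove q τ k.castSucc -
      siteSign (τ k.succ) * weightRemove q τ k.succ := by
  obtain ⟨L, N, h⟩ := exists_opWord_eq_mul_mul (fun i => siteOp q (τ i)) k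
  have hne : k.succ ≠ k.castSucc := by simp [Fin.ext_iff]
  have h1 : weight q τ = (L ((siteOp q (τ k.succ) * siteOp q (τ k.castSucc)) (N 1))).eval 1 := by
    rw [weight, stateVec, h _ fun _ _ _ => rfl]
    rfl
  have h2 : weight q (swapAt k τ) =
      (L ((siteOp q (τ k.castSucc) * siteOp q (τ k.succ)) (N 1))).eval 1 := by
    rw [weight, stateVec, h]
    · simp [swapAt]
    · intro i hi hj
      simp [swapAt, Equiv.swap_apply_of_ne_of_ne hi hj]
  have h3 : weightRemove q τ k.castSucc = (L (siteOp q (τ k.succ) (N 1))).eval 1 := by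
    rw [weightRemove, h]
    · simp [hne]
    · intro i hi _
      simp [hi]
  have h4 : weightRemove q τ k.succ = (L (siteOp q (τ k.castSucc) (N 1))).eval 1 := by
    rw [weightRemove, h]
    · simp [hne.symm]
    · intro i _ hi
      simp [hi]
  rw [h1, h2, h3, h4]
  have key : (L ((opD q * opE) (N 1))).eval 1 - q * (L ((opE * opD q) (N 1))).eval 1 =
      (L (opD q (N 1))).eval 1 + (L (opE (N 1))).eval 1 := by
    rw [← eval_add, ← map_add, ← LinearMap.add_apply, ← opD_mul_opE]
    simp
  cases τ k.succ <;> cases τ k.castSucc <;> simp [siteOp, siteSign] <;>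
    simp only [Module.End.mul_apply] at key <;> linarith

/-- Since `⟨W|E = ⟨W|`, an empty leftmost site may be removed. -/
theorem weight_of_last_eq_false {m : ℕ} (q : ℝ) (τ : State (m + 1)) :
    weight q (Function.update τ (Fin.last m) false) = weightRemove q τ (Fin.last m) := by
  rw [weight, weightRemove, stateVec, opWord, opWord]
  simp [siteOp, eval_opE]

/-- Since `D|V⟩ = |V⟩`, an occupied rightmost site may be removed. -/
theorem weight_of_zero_eq_true {m : ℕ} (q : ℝ) (τ : State (m + 1)) :
    weight q (Function.update τ 0 true) = weightRemove q τ 0 := by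
  rw [weight, weightRemove, stateVec, opWord_succ_right, opWord_succ_right]
  simp [siteOp, opD_one]

theorem weight_balance {n : ℕ} (q : ℝ) (τ : State n) :
    ∑ σ, weight q σ * rate q σ τ = weight q τ * ∑ σ, rate q τ σ := by
  cases n with
  | zero =>
    rw [Finset.mul_sum]
    exact Finset.sum_congr rfl fun σ _ => by rw [Subsingleton.elim σ τ]
  | succ m =>
    have hbulk := Finset.sum_congr rfl fun k (_ : k ∈ Finset.univ) => bond_flow q τ k
    rw [Finset.sum_sub_distrib, ← Finset.mul_sum, Finset.sum_sub_distrib] at hbulk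
    have e1 := Fin.sum_univ_castSucc fun i => siteSign (τ i) * weightRemove q τ i
    have e2 := Fin.sum_univ_succ fun i => siteSign (τ i) * weightRemove q τ i
    have hleft : (if τ (Fin.last m) = true then weight q (Function.update τ (Fin.last m) false)
        else 0) - weight q τ * (if τ (Fin.last m) = false then 1 else 0) =
        siteSign (τ (Fin.last m)) * weightRemove q τ (Fin.last m) := by
      rw [← weight_of_last_eq_false]
      cases h : τ (Fin.last m) with
      | true => simp [siteSign]
      | false =>
        rw [← h, Function.update_eq_self]
        simp [siteSign, h]
    have hright : (if τ 0 = false then weight q (Function.update τ 0 true)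
        else 0) - weight q τ * (if τ 0 = true then 1 else 0) =
        -(siteSign (τ 0) * weightRemove q τ 0) := by
      rw [← weight_of_zero_eq_true]
      cases h : τ 0 with
      | true =>
        rw [← h, Function.update_eq_self]
        simp [siteSign, h]
      | false => simp [siteSign]
    rw [sum_mul_rate_to, sum_rate_from]
    linarith

/-! ### Irreducibility and uniqueness -/

theorem rate_nonneg {n : ℕ} {q : ℝ} (hq : 0 ≤ q) (σ τ : State n) : 0 ≤ rate q σ τ := by
  unfold rate
  split_ifs <;> positivity

theorem rate_pos {n : ℕ} {q : ℝ} (hq : 0 ≤ q) {σ τ : State n}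
    (h : HopRight σ τ ∨ EnterLeft σ τ ∨ ExitRight σ τ) : 0 < rate q σ τ := by
  unfold rate
  rcases h with h | h | h <;> simp only [h, if_true] <;> split_ifs <;> positivity

/-- The total height of the particles, where a particle at site `i` has height `w i`. -/
def height {n : ℕ} (w : Fin n → ℕ) (τ : State n) : ℕ :=
  ∑ i, if τ i = true then w i else 0

theorem height_update_true {n : ℕ} (w : Fin n → ℕ) (τ : State n) (i : Fin n) :
    height w (Function.update τ i true) = height w (Function.update τ i false) + w i := by
  rw [height, height, Fintype.sum_eq_add_sum_compl i, Fintype.sum_eq_add_sum_compl i]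
  simp only [Function.update_self, if_true, Bool.false_eq_true, if_false, zero_add]
  rw [add_comm]
  congr 1
  refine Finset.sum_congr rfl fun j hj => ?_
  have : j ≠ i := by simpa using hj
  simp [this]

theorem height_remove {n : ℕ} (w : Fin n → ℕ) {τ : State n} {i : Fin n} (hi : τ i = true) :
    height w τ = height w (Function.update τ i false) + w i := by
  rw [← height_update_true, ← hi, Function.update_eq_self]

theorem height_move {n : ℕ} (w : Fin n → ℕ) {τ : State n} {i j : Fin n} (hi : τ i = true)
    (hj : τ j = false) :
    height w (Function.update (Function.update τ i false) j true) + w i = height w τ + w j := by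
  have hij : j ≠ i := by
    rintro rfl
    simp [hi] at hj
  have h : (Function.update τ i false) j = false := by simp [hij, hj]
  have h' : Function.update (Function.update τ i false) j false = Function.update τ i false :=
    Function.update_eq_self_iff.2 h.symm
  rw [height_update_true, height_remove w hi, h']
  ring

/-- From every state but the empty one the rightmost particle can move to the right. -/
theorem exists_rate_to {n : ℕ} {q : ℝ} (hq : 0 ≤ q) {τ : State n} (hτ : ∃ i, τ i = true) :
    ∃ σ, 0 < rate q τ σ ∧ height (fun i => i + 1) σ < height (fun i => (i : ℕ) + 1) τ := by
  -- `i` is the rightmost particle: the sites are numbered from right to left.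
  obtain ⟨i, hi, hmin⟩ := (Set.toFinite {i | τ i = true}).exists_minimal hτ
  have hi : τ i = true := hi
  have hlt : ∀ j < i, τ j = false := fun j hj => by
    by_contra h
    exact absurd (hmin (by simpa using h) hj.le) (not_le.2 hj)
  by_cases h0 : (i : ℕ) = 0
  · refine ⟨_, rate_pos hq (.inr (.inr ⟨i, h0, hi, rfl⟩)), ?_⟩
    rw [height_remove _ hi]
    omega
  · obtain ⟨j, hj⟩ : ∃ j : Fin n, (i : ℕ) = j + 1 := ⟨⟨i - 1, by omega⟩, by simp; omega⟩
    have hj' : τ j = false := hlt j (by rw [Fin.lt_def]; omega)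
    refine ⟨_, rate_pos hq (.inl ⟨j, i, hj, hi, hj', rfl⟩), ?_⟩
    have := height_move (fun i => (i : ℕ) + 1) hi hj'
    omega

/-- Every state but the empty one can be reached by a move of its leftmost particle. -/
theorem exists_rate_from {n : ℕ} {q : ℝ} (hq : 0 ≤ q) {τ : State n} (hτ : ∃ i, τ i = true) :
    ∃ σ, 0 < rate q σ τ ∧ height (fun i => n - i) σ < height (fun i => n - (i : ℕ)) τ := by
  -- `i` is the leftmost particle; undo its last step.
  obtain ⟨i, hi, hmax⟩ := (Set.toFinite {i | τ i = true}).exists_maximal hτ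
  have hi : τ i = true := hi
  have hlt : ∀ j, i < j → τ j = false := fun j hj => by
    by_contra h
    exact absurd (hmax (by simpa using h) hj.le) (not_le.2 hj)
  by_cases h0 : (i : ℕ) + 1 = n
  · refine ⟨Function.update τ i false, rate_pos hq (.inr (.inl ⟨i, h0, ?_, ?_⟩)), ?_⟩
    · simp
    · simp [← hi]
    · rw [height_remove _ hi]
      omega
  · obtain ⟨j, hj⟩ : ∃ j : Fin n, (j : ℕ) = i + 1 := ⟨⟨i + 1, by omega⟩, rfl⟩
    have hij : i ≠ j := by
      rintro rfl
      omega
    have hj' : τ j = false := hlt j (by rw [Fin.lt_def]; omega)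
    refine ⟨Function.update (Function.update τ i false) j true,
      rate_pos hq (.inl ⟨i, j, hj, ?_, ?_, ?_⟩), ?_⟩
    · simp
    · simp [hij]
    · rw [Function.update_idem, Function.update_comm hij, Function.update_idem, ← hi,
        ← hj', Function.update_comm hij.symm, Function.update_eq_self, Function.update_eq_self]
    · have := height_move (fun i => n - (i : ℕ)) hi hj'
      omega

/-- The process is irreducible: a nonempty set of states that contains all predecessors of its
elements contains every state. -/
theorem mem_of_predecessor_closed {n : ℕ} {q : ℝ} (hq : 0 ≤ q) {Z : Set (State n)}
    (hne : Z.Nonempty) (hZ : ∀ σ τ, 0 < rate q σ τ → τ ∈ Z → σ ∈ Z) (σ : State n) : σ ∈ Z := by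
  have hempty : (fun _ => false) ∈ Z := by
    obtain ⟨τ, hτ⟩ := hne
    induction h : height (fun i => n - (i : ℕ)) τ using Nat.strong_induction_on generalizing τ with
    | _ k ih =>
      by_cases hx : ∃ i, τ i = true
      · obtain ⟨σ, h1, h2⟩ := exists_rate_from hq hx
        exact ih _ (h ▸ h2) σ (hZ _ _ h1 hτ) rfl
      · push Not at hx
        convert hτ with i
        simpa using (hx i).symm
  induction h : height (fun i => (i : ℕ) + 1) σ using Nat.strong_induction_on generalizing σ with
  | _ k ih =>
    by_cases hx : ∃ i, σ i = true
    · obtain ⟨τ, h1, h2⟩ := exists_rate_to hq hx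
      exact hZ _ _ h1 (ih _ (h ▸ h2) τ rfl)
    · push Not at hx
      convert hempty with i
      simpa using hx i

/-- A nonnegative solution of the balance equations that vanishes at one state is zero. -/
theorem eq_zero_of_balance {n : ℕ} {q : ℝ} (hq : 0 ≤ q) {d : State n → ℝ} (hd : ∀ τ, 0 ≤ d τ)
    (hbal : ∀ τ, ∑ σ, d σ * rate q σ τ = d τ * ∑ σ, rate q τ σ) {τ₀ : State n} (h₀ : d τ₀ = 0)
    (τ : State n) : d τ = 0 := by
  refine mem_of_predecessor_closed hq (Z := {τ | d τ = 0}) ⟨τ₀, h₀⟩ (fun σ τ h hτ => ?_) τ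
  have h1 := hbal τ
  rw [Set.mem_ofPred_eq] at hτ ⊢
  rw [hτ, zero_mul, Finset.sum_eq_zero_iff_of_nonneg fun σ _ =>
    mul_nonneg (hd σ) (rate_nonneg hq σ τ)] at h1
  exact (mul_eq_zero.1 (h1 σ (Finset.mem_univ _))).resolve_right h.ne'

theorem IsSteadyState.eq_of_pos {n : ℕ} {q : ℝ} (hq : 0 ≤ q) {p p' : State n → ℝ}
    (hp : IsSteadyState n q p) (hpos : ∀ τ, 0 < p τ) (hp' : IsSteadyState n q p') : p' = p := by
  obtain ⟨τ₀, -, hmin⟩ :=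
    Finset.exists_min_image Finset.univ (fun τ => p' τ / p τ) Finset.univ_nonempty
  -- Subtracting the largest possible multiple of `p` from `p'` leaves a nonnegative solution.
  set c := p' τ₀ / p τ₀ with hc
  have hzero := eq_zero_of_balance hq (d := fun τ => p' τ - c * p τ) (τ₀ := τ₀)
    (fun τ => sub_nonneg.2 ((le_div_iff₀ (hpos τ)).1 (hmin τ (Finset.mem_univ _))))
    (fun τ => by
      simp only [sub_mul, Finset.sum_sub_distrib, mul_assoc, ← Finset.mul_sum]
      rw [hp.balance, hp'.balance])
    (by rw [hc, div_mul_cancel₀ _ (hpos τ₀).ne', sub_self])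
  have hsum := Finset.sum_congr rfl fun τ (_ : τ ∈ Finset.univ) => sub_eq_zero.1 (hzero τ)
  rw [← Finset.mul_sum, hp.sum_eq_one, hp'.sum_eq_one, mul_one] at hsum
  funext τ
  rw [sub_eq_zero.1 (hzero τ), ← hsum, one_mul]

/-- The normalised matrix product weights form a stationary distribution. -/
theorem isSteadyState_weight (n : ℕ) {q : ℝ} (hq : 0 ≤ q) :
    IsSteadyState n q fun τ => weight q τ / partitionFunction n q where
  nonneg τ := (div_pos (weight_pos hq τ) (partitionFunction_pos n hq)).le
  sum_eq_one := by
    rw [← Finset.sum_div, sum_weight, div_self (partitionFunction_pos n hq).ne']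
  balance τ := by
    simp only [div_mul_eq_mul_div]
    rw [← Finset.sum_div, weight_balance]

/-! ### The weights as sums over subsets -/

theorem qInt_succ (q : ℝ) (k : ℕ) : qInt q (k + 1) = 1 + q * qInt q k := by
  simp only [qInt, Finset.sum_range_succ', pow_zero, pow_succ', Finset.mul_sum]
  ring

theorem qInt_succ_sub (q : ℝ) (k : ℕ) : qInt q (k + 1) - qInt q k = q ^ k := by
  simp [qInt, Finset.sum_range_succ]

/-- Evaluated at `q`-integers, the operator `D` is a `q`-difference operator. -/
theorem eval_opD (q : ℝ) (c : ℕ) (p : ℝ[X]) :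
    q ^ c * (opD q p).eval (qInt q c) =
      qInt q (c + 1) * p.eval (qInt q (c + 1)) - qInt q c * p.eval (qInt q c) := by
  have h : ∀ k, q ^ c * (opDAux q k).eval (qInt q c) =
      qInt q (c + 1) ^ (k + 1) - qInt q c ^ (k + 1) := by
    intro k
    induction k with
    | zero => simp [opDAux, ← qInt_succ_sub]
    | succ k ih =>
      simp only [opDAux, eval_add, eval_mul, eval_one, eval_C, eval_X, eval_pow]
      rw [← qInt_succ q c, mul_add, mul_left_comm, ih, ← qInt_succ_sub q c]
      ring
  rw [opD_eq_sum, eval_finsetSum, Finset.mul_sum, eval_eq_sum_range, eval_eq_sum_range,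
    Finset.mul_sum, Finset.mul_sum, ← Finset.sum_sub_distrib]
  refine Finset.sum_congr rfl fun k _ => ?_
  rw [eval_mul, eval_C, mul_left_comm, h]
  ring

/-- The term of the subset `T ⊆ S` in the expansion of the vector of the state with particles at
the sites of `S ⊆ {1, …, n}`, when `c` further elements lie to the left of all sites. -/
noncomputable def subsetTerm (q : ℝ) (n c : ℕ) (S T : Finset ℕ) : ℝ :=
  (-1 / q) ^ (S.card - T.card) * (q ^ ∑ i ∈ S, (c + (T.filter (i ≤ ·)).card))⁻¹ *
    ∏ k ∈ Finset.Icc 1 n, qInt q (1 + c + (T.filter (k ≤ ·)).card)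

/-- Adding an empty site on the left. -/
theorem subsetTerm_succ (q : ℝ) {n c : ℕ} {S T : Finset ℕ} (hT : ∀ t ∈ T, t ≤ n) :
    subsetTerm q (n + 1) c S T = qInt q (c + 1) * subsetTerm q n c S T := by
  have h : T.filter (n + 1 ≤ ·) = ∅ := by
    refine Finset.filter_eq_empty_iff.2 fun t ht => ?_
    have := hT t ht
    omega
  rw [subsetTerm, subsetTerm, Finset.prod_Icc_succ_top (by omega), h, Finset.card_empty, add_zero,
    add_comm 1 c]
  ring

/-- Adding an occupied site on the left that is not in the subset. -/
theorem subsetTerm_insert (q : ℝ) {n c : ℕ} {S T : Finset ℕ} (hS : ∀ t ∈ S, t ≤ n)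
    (hTS : T ⊆ S) :
    subsetTerm q (n + 1) c (insert (n + 1) S) T =
      -(q ^ (c + 1))⁻¹ * (qInt q (c + 1) * subsetTerm q n c S T) := by
  have hn : n + 1 ∉ S := fun h => by have := hS _ h; omega
  rw [← subsetTerm_succ q fun t ht => hS t (hTS ht), subsetTerm, subsetTerm]
  have h : T.filter (n + 1 ≤ ·) = ∅ := by
    refine Finset.filter_eq_empty_iff.2 fun t ht => ?_
    have := hS t (hTS ht)
    omega
  rw [Finset.card_insert_of_notMem hn, Finset.sum_insert hn, h, Finset.card_empty, add_zero,
    Nat.succ_sub (Finset.card_le_card hTS), pow_succ, pow_add q c, mul_inv, pow_succ q c, mul_inv]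
  ring

/-- Adding an occupied site on the left that is in the subset. -/
theorem subsetTerm_insert_insert (q : ℝ) {n c : ℕ} {S T : Finset ℕ} (hS : ∀ t ∈ S, t ≤ n)
    (hTS : T ⊆ S) :
    subsetTerm q (n + 1) c (insert (n + 1) S) (insert (n + 1) T) =
      (q ^ (c + 1))⁻¹ * (qInt q (c + 2) * subsetTerm q n (c + 1) S T) := by
  have hn : n + 1 ∉ S := fun h => by have := hS _ h; omega
  have hn' : n + 1 ∉ T := fun h => hn (hTS h)
  have hcard : ∀ k ≤ n, ((insert (n + 1) T).filter (k ≤ ·)).card =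
      1 + (T.filter (k ≤ ·)).card := by
    intro k hk
    rw [Finset.filter_insert, if_pos (by omega), Finset.card_insert_of_notMem, add_comm]
    exact fun h => hn' (Finset.mem_filter.1 h).1
  have hlast : ((insert (n + 1) T).filter (n + 1 ≤ ·)).card = 1 := by
    rw [Finset.filter_insert, if_pos le_rfl, Finset.filter_eq_empty_iff.2, insert_empty_eq,
      Finset.card_singleton]
    intro t ht
    have := hS t (hTS ht)
    omega
  rw [subsetTerm, subsetTerm, Finset.card_insert_of_notMem hn, Finset.card_insert_of_notMem hn',
    Nat.add_sub_add_right, Finset.sum_insert hn, hlast, Finset.prod_Icc_succ_top (by omega), hlast,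
    Finset.sum_congr rfl fun i hi => by rw [hcard i (hS i hi), ← add_assoc],
    Finset.prod_congr rfl fun i hi => by
      rw [hcard i (Finset.mem_Icc.1 hi).2, ← add_assoc, add_assoc 1 c 1],
    pow_add, mul_inv, show 1 + c + 1 = c + 2 by ring]
  ring

/-- The sites occupied in `τ`, numbered from `1`. -/
def occupied {n : ℕ} (τ : State n) : Finset ℕ :=
  (Finset.Icc 1 n).filter fun k => ∃ i : Fin n, (i : ℕ) + 1 = k ∧ τ i = true

/-- The value of the matrix product vector at `[c+1]_q`. Reading the sites from left to right, `E`
multiplies by `[c+1]_q`, whereas the two terms of the `q`-difference operator `D` say whether the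
site is skipped or chosen for `T`; choosing it raises `c` by one. -/
theorem eval_stateVec {n : ℕ} {q : ℝ} (hq : q ≠ 0) (τ : State n) (c : ℕ) :
    (stateVec q τ).eval (qInt q (c + 1)) =
      ∑ T ∈ (occupied τ).powerset, subsetTerm q n c (occupied τ) T := by
  induction n generalizing c with
  | zero => simp [stateVec, opWord, occupied, subsetTerm]
  | succ n ih =>
    set τ' : State n := fun i => τ i.castSucc with hτ'
    have hle : ∀ t ∈ occupied τ', t ≤ n := fun t ht => by
      simp only [occupied, Finset.mem_filter, Finset.mem_Icc] at ht
      exact ht.1.2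
    have hn : n + 1 ∉ occupied τ' := fun h => by have := hle _ h; omega
    have hmem : ∀ k, k ∈ occupied τ ↔
        k ∈ occupied τ' ∨ (k = n + 1 ∧ τ (Fin.last n) = true) := by
      intro k
      simp only [occupied, Finset.mem_filter, Finset.mem_Icc, Fin.exists_fin_succ', hτ',
        Fin.val_castSucc, Fin.val_last]
      constructor
      · rintro ⟨h1, ⟨i, hi, h⟩ | ⟨h2, h3⟩⟩
        · exact .inl ⟨⟨h1.1, by omega⟩, i, hi, h⟩
        · exact .inr ⟨h2.symm, h3⟩
      · rintro (⟨h1, h2⟩ | ⟨rfl, h⟩)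
        · exact ⟨⟨h1.1, by omega⟩, .inl h2⟩
        · exact ⟨by omega, .inr ⟨rfl, h⟩⟩
    rw [stateVec_succ]
    cases h : τ (Fin.last n) with
    | false =>
      have hocc : occupied τ = occupied τ' := by
        ext k
        simp [hmem, h]
      rw [hocc, Finset.sum_congr rfl fun T hT =>
        subsetTerm_succ q fun t ht => hle t (Finset.mem_powerset.1 hT ht), ← Finset.mul_sum, ← ih]
      simp [siteOp, opE, hτ']
    | true =>
      have hocc : occupied τ = insert (n + 1) (occupied τ') := by
        ext k
        simp [hmem, h, or_comm]
      have hD := eval_opD q (c + 1) (stateVec q τ')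
      rw [hocc, Finset.sum_powerset_insert hn, Finset.sum_congr rfl fun T hT =>
          subsetTerm_insert q hle (Finset.mem_powerset.1 hT),
        Finset.sum_congr rfl fun T hT =>
          subsetTerm_insert_insert q hle (Finset.mem_powerset.1 hT),
        ← Finset.mul_sum, ← Finset.mul_sum, ← Finset.mul_sum, ← Finset.mul_sum, ← ih, ← ih]
      rw [mul_comm, ← eq_div_iff (pow_ne_zero _ hq)] at hD
      rw [siteOp, if_pos rfl, hD]
      ring

/-- The expansion of the weight of a state over the subsets of its set of particles. -/
theorem weight_eq_sum {n : ℕ} {q : ℝ} (hq : q ≠ 0) (τ : State n) :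
    weight q τ = ∑ T ∈ (occupied τ).powerset, subsetTerm q n 0 (occupied τ) T := by
  rw [← eval_stateVec hq, weight]
  simp [qInt]

/-! ### Compositions and their descent sets -/

theorem mem_des {m : ℕ} (I : Composition m) (k : ℕ) :
    k ∈ des I ↔ ∃ i, (1 ≤ i ∧ i < I.length) ∧ I.sizeUpTo i = k := by
  simp [des]

theorem sizeUpTo_lt_sizeUpTo {m : ℕ} (I : Composition m) {i j : ℕ} (hij : i < j)
    (hj : j ≤ I.length) : I.sizeUpTo i < I.sizeUpTo j :=
  (I.sizeUpTo_strict_mono (hij.trans_le hj)).trans_le (I.monotone_sizeUpTo hij)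

theorem sizeUpTo_le_sizeUpTo_iff {m : ℕ} (I : Composition m) {i j : ℕ} (hi : i ≤ I.length) :
    I.sizeUpTo i ≤ I.sizeUpTo j ↔ i ≤ j := by
  constructor
  · intro h
    by_contra hlt
    exact absurd (sizeUpTo_lt_sizeUpTo I (not_le.1 hlt) hi) (not_lt.2 h)
  · exact fun h => I.monotone_sizeUpTo h

theorem injOn_sizeUpTo {m : ℕ} (I : Composition m) :
    Set.InjOn I.sizeUpTo (Finset.Ico 1 I.length) := by
  intro i hi j hj h
  rw [Finset.coe_Ico, Set.mem_Ico] at hi hj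
  exact le_antisymm ((sizeUpTo_le_sizeUpTo_iff I hi.2.le).1 h.le)
    ((sizeUpTo_le_sizeUpTo_iff I hj.2.le).1 h.ge)

theorem card_des {m : ℕ} (I : Composition m) : (des I).card = I.length - 1 := by
  rw [des, Finset.card_image_of_injOn (injOn_sizeUpTo I), Nat.card_Ico]

theorem card_des_add_one {n : ℕ} (I : Composition (n + 1)) : (des I).card + 1 = I.length := by
  have := I.length_pos_iff.2 n.succ_pos
  rw [card_des]
  omega

theorem des_subset {n : ℕ} (I : Composition (n + 1)) : des I ⊆ Finset.Icc 1 n := by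
  intro k hk
  obtain ⟨i, ⟨h1, h2⟩, rfl⟩ := (mem_des I k).1 hk
  have h3 := sizeUpTo_lt_sizeUpTo I (i := 0) h1 h2.le
  have h4 := sizeUpTo_lt_sizeUpTo I h2 le_rfl
  rw [I.sizeUpTo_length] at h4
  rw [I.sizeUpTo_zero] at h3
  rw [Finset.mem_Icc]
  omega

/-- The boundaries of a composition in Mathlib's sense are its descents and the two endpoints. -/
theorem mem_boundaries_iff {n : ℕ} (I : Composition (n + 1)) (v : Fin (n + 2)) :
    v ∈ I.boundaries ↔ (v : ℕ) = 0 ∨ (v : ℕ) = n + 1 ∨ (v : ℕ) ∈ des I := by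
  have hpos := I.length_pos_iff.2 n.succ_pos
  have h : v ∈ I.boundaries ↔ ∃ i, i ≤ I.length ∧ I.sizeUpTo i = v := by
    simp [Composition.boundaries, Composition.boundary, Fin.exists_iff, Fin.ext_iff]
  rw [h, mem_des]
  constructor
  · rintro ⟨i, hi, hv⟩
    rcases Nat.eq_zero_or_pos i with rfl | h0
    · exact .inl (by rw [← hv, I.sizeUpTo_zero])
    · rcases hi.eq_or_lt with rfl | hlt
      · exact .inr (.inl (by rw [← hv, I.sizeUpTo_length]))
      · exact .inr (.inr ⟨i, ⟨h0, hlt⟩, hv⟩)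
  · rintro (hv | hv | ⟨i, hi, hv⟩)
    · exact ⟨0, hpos.le, by rw [hv, I.sizeUpTo_zero]⟩
    · exact ⟨I.length, le_rfl, by rw [hv, I.sizeUpTo_length]⟩
    · exact ⟨i, hi.2.le, hv⟩

theorem des_injective {n : ℕ} : Function.Injective (des : Composition (n + 1) → Finset ℕ) := by
  intro I J h
  apply (compositionEquiv (n + 1)).injective
  apply CompositionAsSet.ext
  change I.boundaries = J.boundaries
  ext v
  rw [mem_boundaries_iff, mem_boundaries_iff, h]

/-- Together with `des_injective` and `des_subset`: taking descent sets identifies the compositions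
of `n + 1` with the subsets of `{1, …, n}`. -/
theorem exists_des_eq {n : ℕ} {T : Finset ℕ} (hT : T ⊆ Finset.Icc 1 n) :
    ∃ J : Composition (n + 1), des J = T := by
  let c : CompositionAsSet (n + 1) :=
    { boundaries := Finset.univ.filter fun v => (v : ℕ) = 0 ∨ (v : ℕ) = n + 1 ∨ (v : ℕ) ∈ T
      zero_mem := by simp
      getLast_mem := by simp }
  refine ⟨c.toComposition, ?_⟩
  have key : ∀ v : Fin (n + 2),
      ((v : ℕ) = 0 ∨ (v : ℕ) = n + 1 ∨ (v : ℕ) ∈ des c.toComposition) ↔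
        ((v : ℕ) = 0 ∨ (v : ℕ) = n + 1 ∨ (v : ℕ) ∈ T) := by
    intro v
    rw [← mem_boundaries_iff, CompositionAsSet.toComposition_boundaries]
    simp [c]
  ext k
  by_cases hk : k ∈ Finset.Icc 1 n
  · have hk' := Finset.mem_Icc.1 hk
    have := key ⟨k, by omega⟩
    simpa [show k ≠ 0 by omega, show k ≠ n + 1 by omega] using this
  · exact iff_of_false (fun h => hk (des_subset _ h)) fun h => hk (hT h)

/-- The descents to the right of the position `j` correspond to the blocks after that of `j`. -/
theorem card_filter_des {m : ℕ} (J : Composition m) (j : Fin m) :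
    1 + ((des J).filter ((j : ℕ) + 1 ≤ ·)).card = J.length - J.index j := by
  have h : (des J).filter ((j : ℕ) + 1 ≤ ·) =
      (Finset.Ico (J.index j + 1 : ℕ) J.length).image J.sizeUpTo := by
    ext k
    simp only [Finset.mem_filter, mem_des, Finset.mem_image, Finset.mem_Ico]
    constructor
    · rintro ⟨⟨i, hi, rfl⟩, h⟩
      refine ⟨i, ⟨?_, hi.2⟩, rfl⟩
      by_contra hlt
      have h1 := J.monotone_sizeUpTo (show i ≤ J.index j by omega)
      have h2 := J.sizeUpTo_index_le j
      omega
    · rintro ⟨i, hi, rfl⟩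
      refine ⟨⟨i, ⟨by omega, hi.2⟩, rfl⟩, ?_⟩
      exact (J.lt_sizeUpTo_index_succ j).trans_le (J.monotone_sizeUpTo hi.1)
  rw [h, Finset.card_image_of_injOn, Nat.card_Ico]
  · have := (J.index j).2
    omega
  · refine (injOn_sizeUpTo J).mono fun i hi => ?_
    rw [Finset.coe_Ico, Set.mem_Ico] at hi ⊢
    omega

/-- The generalized `q`-factorial as a product over the sites. -/
theorem qFact_eq_prod {n : ℕ} (q : ℝ) (J : Composition (n + 1)) :
    qFact q J = ∏ k ∈ Finset.Icc 1 n, qInt q (1 + ((des J).filter (k ≤ ·)).card) := by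
  have hlast : (des J).filter (n + 1 ≤ ·) = ∅ := by
    refine Finset.filter_eq_empty_iff.2 fun t ht => ?_
    have := (Finset.mem_Icc.1 (des_subset J ht)).2
    omega
  calc qFact q J = ∏ j : Fin (n + 1), qInt q (J.length - J.index j) := by
        rw [← Composition.prod_prod_apply_embedding _ J]
        simp [qFact, Composition.index_embedding]
    _ = ∏ k ∈ Finset.range (n + 1), qInt q (1 + ((des J).filter (k + 1 ≤ ·)).card) := by
        rw [Finset.prod_range]
        exact Finset.prod_congr rfl fun j _ => by rw [card_filter_des]
    _ = _ := by
        rw [Finset.prod_range_succ, hlast, Finset.range_eq_Ico,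
          Finset.prod_Ico_add' (fun k => qInt q (1 + ((des J).filter (k ≤ ·)).card)) 0 n 1]
        simp [qInt, Finset.Ico_add_one_right_eq_Icc]

theorem st'_eq_sum {m : ℕ} (I J : Composition m) :
    st' I J = ∑ i ∈ des I, ((des J).filter (i ≤ ·)).card := by
  simp only [st', Finset.card_filter, Finset.sum_product]

theorem occupied_stateOf {n : ℕ} (I : Composition (n + 1)) : occupied (stateOf I) = des I := by
  ext k
  simp only [occupied, stateOf, Finset.mem_filter, decide_eq_true_eq]
  constructor
  · rintro ⟨-, i, rfl, h⟩
    exact h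
  · intro h
    have hk := des_subset I h
    have hk' := Finset.mem_Icc.1 hk
    exact ⟨hk, ⟨k - 1, by omega⟩, by simp; omega, by simpa [Nat.sub_add_cancel hk'.1] using h⟩

/-- The closed formula computes the matrix product weights. -/
theorem weight_stateOf {n : ℕ} (I : Composition (n + 1)) {q : ℝ} (hq : q ≠ 0) :
    weight q (stateOf I) = formula I q := by
  rw [weight_eq_sum hq, occupied_stateOf, formula]
  symm
  refine Finset.sum_bij (fun J _ => des J) (fun J hJ => ?_) (fun J _ J' _ h => des_injective h)
    (fun T hT => ?_) fun J hJ => ?_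
  · exact Finset.mem_powerset.2 (Finset.mem_filter.1 hJ).2
  · rw [Finset.mem_powerset] at hT
    obtain ⟨J, rfl⟩ := exists_des_eq (hT.trans (des_subset I))
    exact ⟨J, by simp [coarser, hT], rfl⟩
  · have hle := Finset.card_le_card (Finset.mem_filter.1 hJ).2
    rw [← card_des_add_one I, ← card_des_add_one J, qFact_eq_prod, st'_eq_sum, subsetTerm,
      zpow_neg, zpow_natCast]
    have : ((((des I).card + 1 : ℕ) : ℤ) - (((des J).card + 1 : ℕ) : ℤ)) =
        (((des I).card - (des J).card : ℕ) : ℤ) := by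
      push_cast [hle]
      ring
    rw [this, zpow_natCast]
    simp

end PASEP

theorem mainTheorem7 (n : ℕ) (q : ℝ) (hq : 0 ≤ q) :
    ∃ p : PASEP.State n → ℝ,
      PASEP.IsSteadyState n q p ∧
      (∀ p' : PASEP.State n → ℝ, PASEP.IsSteadyState n q p' → p' = p) ∧
      ∀ I : Composition (n + 1),
        (q ≠ 0 → p (PASEP.stateOf I) = PASEP.formula I q / PASEP.partitionFunction n q) ∧
        ∃ P : Polynomial ℝ, (∀ x : ℝ, x ≠ 0 → P.eval x = PASEP.formula I x) ∧
          p (PASEP.stateOf I) = P.eval q / PASEP.partitionFunction n q := by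
  have hp := PASEP.isSteadyState_weight n hq
  refine ⟨_, hp, fun p' hp' => hp.eq_of_pos hq (fun τ => div_pos (PASEP.weight_pos hq τ)
    (PASEP.partitionFunction_pos n hq)) hp', fun I => ⟨fun h => ?_, ?_⟩⟩
  · rw [PASEP.weight_stateOf I h]
  · obtain ⟨P, hP⟩ := PASEP.exists_eval_eq_weight (PASEP.stateOf I)
    exact ⟨P, fun x hx => by rw [hP, PASEP.weight_stateOf I hx], by rw [hP]⟩
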